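/- Let $\mathbb{K}=\mathbb{R}$ or $\mathbb{K}=\mathbb{C}$, let $H$ be a finite-dimensional Hilbert space over $\mathbb{K}$, let $\mathcal{V}\subseteq H$ be a linear subspace, and let $\Lambda: H\to\mathbb{K}^m$ be a linear map with $\mathcal{V}\cap\ker\Lambda=\{0\}$, where $\mathbb{K}^m$ carries the $\ell_2$-norm. Let $\varepsilon>0$ and $\eta\ge 0$, and put $$\mathcal{K}=\{f\in H:\ \mathrm{dist}(f,\mathcal{V})\le\varepsilon\},\qquad \mathcal{E}=\{e\in\mathbb{K}^m:\ \|e\|_2\le\eta\}.$$ For an arbitrary (not necessarily linear) map $\Delta:\mathbb{K}^m\to H$, define its global worst-case error by $$\mathrm{gwce}(\Delta)=\sup_{f\in\mathcal{K},\ e\in\mathcal{E}}\|f-\Delta(\Lambda f+e)\|\in[0,\infty].$$ Let $P_{\mathcal{V}^\perp}$ be the orthogonal projector onto $\mathcal{V}^\perp$, and consider the semidefinite program $$\min_{c,d\ge 0}\ c\,\varepsilon^2+d\,\eta^2\qquad\text{subject to}\qquad cP_{\mathcal{V}^\perp}+d\Lambda^*\Lambda\succeq\mathrm{Id}.$$ If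 $\eta>0$, this program has a solution. Moreover, for every solution $(c_\flat,d_\flat)$, set $\tau_\flat=d_\flat/(c_\flat+d_\flat)$ (with $\tau_\flat=0$ if $c_\flat=d_\flat=0$, which can occur only if $H=\{0\}$). Then for every $y\in\mathbb{K}^m$ the program $$\min_{f\in H}\ (1-\tau_\flat)\|P_{\mathcal{V}^\perp}f\|^2+\tau_\flat\|\Lambda f-y\|_2^2$$ has a unique minimizer $\Delta_{\tau_\flat}(y)$, the map $\Delta_{\tau_\flat}:\mathbb{K}^m\to H$ is linear, and it is a globally optimal recovery map: $$\mathrm{gwce}(\Delta_{\tau_\flat})=\inf_{\Delta:\mathbb{K}^m\to H}\mathrm{gwce}(\Delta),$$ the infimum being taken over all maps $\Delta:\mathbb{K}^m\to H$. -/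

import Mathlib

noncomputable section

namespace OptRec

open scoped ENNReal

section

variable {𝕜 : Type*} [RCLike 𝕜] {H : Type*} [NormedAddCommGroup H] [InnerProductSpace 𝕜 H]
  {m : ℕ}

/-- The approximability set of all elements of `H` at distance at most `ε` from `V`. -/
def approxSet (V : Submodule 𝕜 H) (ε : ℝ) : Set H :=
  {f | Metric.infDist f (V : Set H) ≤ ε}

/-- The uncertainty set of all error vectors of `ℓ₂`-norm at most `η`. -/
def uncertaintySet (𝕜 : Type*) [RCLike 𝕜] (m : ℕ) (η : ℝ) : Set (EuclideanSpace 𝕜 (Fin m)) :=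
  {e | ‖e‖ ≤ η}

/-- The global worst-case error of an arbitrary recovery map `Δ`, with values in `[0, ∞]`. -/
def gwce (K : Set H) (E : Set (EuclideanSpace 𝕜 (Fin m)))
    (Λ : H →ₗ[𝕜] EuclideanSpace 𝕜 (Fin m)) (Δ : EuclideanSpace 𝕜 (Fin m) → H) : ℝ≥0∞ :=
  ⨆ f ∈ K, ⨆ e ∈ E, ‖f - Δ (Λ f + e)‖ₑ

variable [FiniteDimensional 𝕜 H]

/-- The objective function `(1 - τ) ‖P f‖² + τ ‖Λ f - y‖²` of the regularization program, where
`P` is the orthogonal projector onto the orthogonal complement of `V`. -/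
def regObjective (V : Submodule 𝕜 H) (Λ : H →ₗ[𝕜] EuclideanSpace 𝕜 (Fin m)) (τ : ℝ)
    (y : EuclideanSpace 𝕜 (Fin m)) (f : H) : ℝ :=
  (1 - τ) * ‖Vᗮ.starProjection f‖ ^ 2 + τ * ‖Λ f - y‖ ^ 2

/-- `Δ` is the regularization map with parameter `τ`: for each `y`, the regularization program
has `Δ y` as its one and only minimizer. -/
def IsRegularizationMap (V : Submodule 𝕜 H) (Λ : H →ₗ[𝕜] EuclideanSpace 𝕜 (Fin m)) (τ : ℝ)
    (Δ : EuclideanSpace 𝕜 (Fin m) → H) : Prop :=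
  ∀ (y : EuclideanSpace 𝕜 (Fin m)) (f : H),
    IsMinOn (regObjective V Λ τ y) Set.univ f ↔ f = Δ y

/-- The feasible set of the semidefinite program: the pairs `(c, d)` of nonnegative numbers such
that `c P + d Λ* Λ - Id` is positive semidefinite. -/
def sdpFeasible (V : Submodule 𝕜 H) (Λ : H →ₗ[𝕜] EuclideanSpace 𝕜 (Fin m)) : Set (ℝ × ℝ) :=
  {p | 0 ≤ p.1 ∧ 0 ≤ p.2 ∧
    ((p.1 : 𝕜) • (Vᗮ.starProjection : H →ₗ[𝕜] H) + (p.2 : 𝕜) • (LinearMap.adjoint Λ ∘ₗ Λ)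
      - LinearMap.id).IsPositive}

/-- `(c, d)` is a solution of the semidefinite program: minimize `c ε² + d η²` over the
feasible set. -/
def IsSDPSolution (V : Submodule 𝕜 H) (Λ : H →ₗ[𝕜] EuclideanSpace 𝕜 (Fin m)) (ε η c d : ℝ) :
    Prop :=
  (c, d) ∈ sdpFeasible V Λ ∧
    IsMinOn (fun p : ℝ × ℝ => p.1 * ε ^ 2 + p.2 * η ^ 2) (sdpFeasible V Λ) (c, d)

end

end OptRec

end

/-!
Write `P` for the projector onto `Vᗮ`. The semidefinite constraint says that
`‖f‖² ≤ c ‖P f‖² + d ‖Λ f‖²` for all `f`.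

Upper bound: if `Δ` solves the normal equations of the regularization program, the Pythagorean
identity `c ‖P f‖² + d ‖e‖² = [minimal value] + c ‖P g‖² + d ‖Λ g‖²` with `g = f - Δ (Λ f + e)`
gives `‖g‖² ≤ c ‖P f‖² + d ‖e‖² ≤ c ε² + d η²`.

Lower bound: an `f` with `‖P f‖ ≤ ε` and `‖Λ f‖ ≤ η` cannot be told apart from `-f`, as both may
produce the observation `0`, so every recovery map has error at least `‖f‖`.

The bounds meet by strong duality. Let `v = c ε² + d η²` be the optimal value. Perturbing `c`,
respectively `d`, upwards and passing to the limit by compactness yields vectors where the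
constraint is tight and `v ‖P f‖² ≤ ε² ‖f‖²`, respectively `v ‖Λ f‖² ≤ η² ‖f‖²`. Tight vectors form
a subspace, and the intermediate value theorem on it gives one vector with both properties; scale
it to `‖f‖² = v`.
-/

namespace OptRec

open Filter Topology
open scoped InnerProductSpace

section General

theorem exists_eq_zero_and_nonpos_of_forall_add_mul_nonpos {X : Type*} [TopologicalSpace X]
    {S : Set X} (hS : IsCompact S) {Q R : X → ℝ} (hQ : Continuous Q) (hR : Continuous R)
    (hQ_nonneg : ∀ x ∈ S, 0 ≤ Q x) (h : ∀ t > 0, ∃ x ∈ S, Q x + t * R x ≤ 0) :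
    ∃ x ∈ S, Q x = 0 ∧ R x ≤ 0 := by
  have hT : IsCompact (S ∩ {x | R x ≤ 0}) := hS.inter_right (isClosed_le hR continuous_const)
  have h_mem : ∀ t > 0, ∃ x ∈ S ∩ {x | R x ≤ 0}, Q x + t * R x ≤ 0 := by
    intro t ht
    obtain ⟨x, hxS, hx⟩ := h t ht
    exact ⟨x, ⟨hxS, nonpos_of_mul_nonpos_right (by linarith [hQ_nonneg x hxS]) ht⟩, hx⟩
  obtain ⟨x₁, hx₁, -⟩ := h_mem 1 one_pos
  obtain ⟨x, hxT, hQ_min⟩ := hT.exists_isMinOn ⟨x₁, hx₁⟩ hQ.continuousOn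
  obtain ⟨z, -, hR_min⟩ := hT.exists_isMinOn ⟨x₁, hx₁⟩ hR.continuousOn
  have hQ_le : ∀ t > 0, Q x ≤ t * -R z := by
    intro t ht
    obtain ⟨w, hwT, hw⟩ := h_mem t ht
    have hQw : Q x ≤ Q w := hQ_min hwT
    have hRw : t * R z ≤ t * R w := mul_le_mul_of_nonneg_left (hR_min hwT) ht.le
    linarith
  have h_lim : Tendsto (fun t : ℝ => t * -R z) (𝓝[>] 0) (𝓝 0) := by
    have : Continuous fun t : ℝ => t * -R z := by fun_prop
    simpa using (this.tendsto 0).mono_left nhdsWithin_le_nhds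
  have hQx : Q x ≤ 0 := ge_of_tendsto h_lim (eventually_mem_nhdsWithin.mono hQ_le)
  exact ⟨x, hxT.1, hQx.antisymm (hQ_nonneg x hxT.1), hxT.2⟩

theorem norm_le_max_norm_sub_norm_add (𝕜 : Type*) [RCLike 𝕜] {H : Type*} [NormedAddCommGroup H]
    [NormedSpace 𝕜 H] (f z : H) : ‖f‖ ≤ max ‖f - z‖ ‖f + z‖ := by
  have h_two : 2 * ‖f‖ = ‖(f - z) + (f + z)‖ := by
    rw [← RCLike.norm_two (K := 𝕜), ← norm_smul, two_smul]
    congr 1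
    abel
  have h_add := norm_add_le (f - z) (f + z)
  have h_sub := le_max_left ‖f - z‖ ‖f + z‖
  have h_sum := le_max_right ‖f - z‖ ‖f + z‖
  linarith

variable {𝕜 : Type*} [RCLike 𝕜] {H : Type*} [NormedAddCommGroup H] [NormedSpace 𝕜 H]
  {q : H → ℝ}

theorem exists_mem_ne_zero_eq_zero_of_nonpos_of_nonneg (hq : Continuous q)
    (hq_smul : ∀ (a : 𝕜) (f : H), q (a • f) = ‖a‖ ^ 2 * q f) {W : Submodule 𝕜 H} {f g : H}
    (hfW : f ∈ W) (hgW : g ∈ W) (hf : f ≠ 0) (hqf : q f ≤ 0) (hg : g ≠ 0) (hqg : 0 ≤ q g) :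
    ∃ u ∈ W, u ≠ 0 ∧ q u = 0 := by
  by_cases h_dep : ∃ a : 𝕜, a • f = g
  · obtain ⟨a, rfl⟩ := h_dep
    rw [hq_smul] at hqg
    have ha : 0 < ‖a‖ := norm_pos_iff.mpr (left_ne_zero_of_smul hg)
    exact ⟨f, hfW, hf, hqf.antisymm (nonneg_of_mul_nonneg_right hqg (by positivity))⟩
  · let γ : ℝ → H := fun t => ((1 - t : ℝ) : 𝕜) • f + (t : 𝕜) • g
    have hγ : Continuous γ := by
      have : Continuous ((↑) : ℝ → 𝕜) := RCLike.continuous_ofReal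
      fun_prop
    obtain ⟨t, -, ht⟩ := intermediate_value_Icc zero_le_one (hq.comp hγ).continuousOn
      (show (0 : ℝ) ∈ Set.Icc _ _ by simpa [γ] using ⟨hqf, hqg⟩)
    refine ⟨γ t, W.add_mem (W.smul_mem _ hfW) (W.smul_mem _ hgW), fun hγt => ?_, ht⟩
    have ht0 : (t : 𝕜) ≠ 0 := by
      intro ht0
      obtain rfl : t = 0 := by exact_mod_cast ht0
      exact hf (by simpa [γ] using hγt)
    refine h_dep ⟨-(t : 𝕜)⁻¹ * ((1 - t : ℝ) : 𝕜), ?_⟩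
    rw [mul_smul, eq_neg_of_add_eq_zero_left hγt, neg_smul, smul_neg, neg_neg,
      inv_smul_smul₀ ht0]

theorem mul_norm_sq_le_of_forall_norm_eq_one
    (hq_smul : ∀ (a : 𝕜) (f : H), q (a • f) = ‖a‖ ^ 2 * q f) {γ : ℝ}
    (h : ∀ f : H, ‖f‖ = 1 → γ ≤ q f) (f : H) : γ * ‖f‖ ^ 2 ≤ q f := by
  rcases eq_or_ne f 0 with rfl | hf
  · simpa using (hq_smul 0 0).ge
  · have h_unit := h (((‖f‖ : 𝕜)⁻¹) • f) (norm_smul_inv_norm hf)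
    rwa [hq_smul, norm_inv, RCLike.norm_ofReal, abs_norm, inv_pow, ← div_eq_inv_mul,
      le_div_iff₀ (by positivity)] at h_unit

theorem exists_lt_forall_mul_norm_sq_le [FiniteDimensional 𝕜 H] (hq : Continuous q)
    (hq_smul : ∀ (a : 𝕜) (f : H), q (a • f) = ‖a‖ ^ 2 * q f) {γ₀ : ℝ}
    (h : ∀ f : H, ‖f‖ = 1 → γ₀ < q f) : ∃ γ > γ₀, ∀ f : H, γ * ‖f‖ ^ 2 ≤ q f := by
  have : ProperSpace H := FiniteDimensional.proper_rclike 𝕜 H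
  obtain ⟨γ, hγ, hle⟩ := (isCompact_sphere (0 : H) 1).exists_forall_le' hq.continuousOn
    (fun f hf => h f (mem_sphere_zero_iff_norm.mp hf))
  exact ⟨γ, hγ, mul_norm_sq_le_of_forall_norm_eq_one hq_smul fun f hf =>
    hle f (mem_sphere_zero_iff_norm.mpr hf)⟩

end General

section Energy

variable {𝕜 : Type*} [RCLike 𝕜]
  {H : Type*} [NormedAddCommGroup H] [InnerProductSpace 𝕜 H]
  {E : Type*} [NormedAddCommGroup E] [InnerProductSpace 𝕜 E]
  {F : Type*} [NormedAddCommGroup F] [InnerProductSpace 𝕜 F]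

/-- The quadratic form of the operator `c A* A + d B* B`, written without adjoints. With `A` the
projector onto `Vᗮ` and `B = Λ`, it is the form of the semidefinite constraint. -/
def energy (A : H →ₗ[𝕜] E) (B : H →ₗ[𝕜] F) (c d : ℝ) (f : H) : ℝ :=
  c * ‖A f‖ ^ 2 + d * ‖B f‖ ^ 2

/-- The pairs of nonnegative weights for which the energy dominates the squared norm; this is the
feasible set of the semidefinite program in terms of quadratic forms. -/
def dominatingPairs (A : H →ₗ[𝕜] E) (B : H →ₗ[𝕜] F) : Set (ℝ × ℝ) :=
  {p | 0 ≤ p.1 ∧ 0 ≤ p.2 ∧ ∀ f, ‖f‖ ^ 2 ≤ energy A B p.1 p.2 f}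

/-- The Tikhonov functional with observation `y`, with independent weights `c` and `d`; the
objective of the regularization program is the case `c = 1 - τ`, `d = τ`. -/
def tikhonov (A : H →ₗ[𝕜] E) (B : H →ₗ[𝕜] F) (c d : ℝ) (y : F) (f : H) : ℝ :=
  c * ‖A f‖ ^ 2 + d * ‖B f - y‖ ^ 2

variable {A : H →ₗ[𝕜] E} {B : H →ₗ[𝕜] F} {c d ε η : ℝ}

theorem energy_smul (a : 𝕜) (f : H) : energy A B c d (a • f) = ‖a‖ ^ 2 * energy A B c d f := by
  simp only [energy, map_smul, norm_smul]
  ring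

theorem energy_nonneg (hc : 0 ≤ c) (hd : 0 ≤ d) (f : H) : 0 ≤ energy A B c d f := by
  unfold energy
  positivity

theorem energy_div (γ : ℝ) (f : H) :
    energy A B (c / γ) (d / γ) f = energy A B c d f / γ := by
  simp only [energy]
  ring

theorem energy_parallelogram (f g : H) :
    energy A B c d (f + g) + energy A B c d (f - g) =
      2 * (energy A B c d f + energy A B c d g) := by
  have hA := parallelogram_law_with_norm 𝕜 (A f) (A g)
  have hB := parallelogram_law_with_norm 𝕜 (B f) (B g)
  simp only [energy, map_add, map_sub]
  linear_combination c * hA + d * hB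

theorem continuous_energy [FiniteDimensional 𝕜 H] : Continuous (energy A B c d) := by
  have hA : Continuous A := A.continuous_of_finiteDimensional
  have hB : Continuous B := B.continuous_of_finiteDimensional
  unfold energy
  fun_prop

theorem div_mem_dominatingPairs {γ : ℝ} (hc : 0 ≤ c) (hd : 0 ≤ d) (hγ : 0 < γ)
    (h : ∀ f, γ * ‖f‖ ^ 2 ≤ energy A B c d f) : (c / γ, d / γ) ∈ dominatingPairs A B := by
  refine ⟨by positivity, by positivity, fun f => ?_⟩
  rw [energy_div, le_div_iff₀ hγ, mul_comm]
  exact h f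

theorem isClosed_dominatingPairs : IsClosed (dominatingPairs A B) := by
  simp only [dominatingPairs, energy, Set.ofPred_and, Set.ofPred_forall]
  refine (isClosed_le ?_ ?_).inter ((isClosed_le ?_ ?_).inter (isClosed_iInter fun f =>
    isClosed_le ?_ ?_)) <;> fun_prop

theorem dominatingPairs_nonempty [FiniteDimensional 𝕜 H]
    (hAB : LinearMap.ker A ⊓ LinearMap.ker B = ⊥) : (dominatingPairs A B).Nonempty := by
  have h_pos : ∀ f : H, ‖f‖ = 1 → 0 < energy A B 1 1 f := by
    refine fun f hf => (energy_nonneg zero_le_one zero_le_one f).lt_of_ne' fun h_zero => ?_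
    have h_ker : f ∈ LinearMap.ker A ⊓ LinearMap.ker B := by
      simpa [energy, add_eq_zero_iff_of_nonneg (sq_nonneg ‖A f‖) (sq_nonneg ‖B f‖)] using h_zero
    rw [hAB, Submodule.mem_bot] at h_ker
    simp [h_ker] at hf
  obtain ⟨γ, hγ, hle⟩ := exists_lt_forall_mul_norm_sq_le continuous_energy energy_smul h_pos
  exact ⟨_, div_mem_dominatingPairs zero_le_one zero_le_one hγ hle⟩

theorem exists_isMinOn_dominatingPairs [FiniteDimensional 𝕜 H]
    (hAB : LinearMap.ker A ⊓ LinearMap.ker B = ⊥) {α β : ℝ} (hα : 0 < α) (hβ : 0 < β) :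
    ∃ p ∈ dominatingPairs A B,
      IsMinOn (fun p : ℝ × ℝ => p.1 * α + p.2 * β) (dominatingPairs A B) p := by
  obtain ⟨p₀, hp₀⟩ := dominatingPairs_nonempty hAB
  set v := p₀.1 * α + p₀.2 * β
  refine ContinuousOn.exists_isMinOn' (by fun_prop) isClosed_dominatingPairs hp₀ ?_
  have h_outside : ∀ᶠ p in cocompact (ℝ × ℝ), p ∉ Set.Icc (0, 0) (v / α, v / β) :=
    isCompact_Icc.compl_mem_cocompact
  filter_upwards [mem_inf_of_left h_outside, mem_inf_of_right (mem_principal_self _)]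
    with p hp ⟨hp₁, hp₂, _⟩
  by_contra! h_lt
  have h₁ : 0 ≤ p.1 * α := by positivity
  have h₂ : 0 ≤ p.2 * β := by positivity
  exact hp ⟨⟨hp₁, hp₂⟩, (le_div_iff₀ hα).mpr (by linarith), (le_div_iff₀ hβ).mpr (by linarith)⟩

/-- The vectors at which the constraint `‖f‖² ≤ energy A B c d f` is an equality. -/
def tightSubspace (h : ∀ f, ‖f‖ ^ 2 ≤ energy A B c d f) : Submodule 𝕜 H where
  carrier := {f | energy A B c d f = ‖f‖ ^ 2}
  zero_mem' := by simp [energy]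
  add_mem' := by
    -- the difference of the two sides is a nonnegative form obeying the parallelogram law
    rintro f g (hf : energy A B c d f = _) (hg : energy A B c d g = _)
    have h_energy := energy_parallelogram (A := A) (B := B) (c := c) (d := d) f g
    have h_norm := parallelogram_law_with_norm 𝕜 f g
    exact le_antisymm (by linarith [h (f - g)]) (h (f + g))
  smul_mem' := by
    rintro a f (hf : energy A B c d f = _)
    simp only [Set.mem_ofPred_eq, energy_smul, norm_smul, mul_pow, hf]

theorem exists_norm_eq_one_mul_energy_le [FiniteDimensional 𝕜 H] {v α β : ℝ} (hv : 0 < v)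
    (h_min : ∀ p ∈ dominatingPairs A B, v ≤ p.1 * α + p.2 * β) (hα : 0 ≤ α) (hβ : 0 ≤ β)
    (hc : 0 ≤ c) (hd : 0 ≤ d) : ∃ f : H, ‖f‖ = 1 ∧ v * energy A B c d f ≤ c * α + d * β := by
  by_contra! h_gt
  obtain ⟨γ, hγ, hle⟩ := exists_lt_forall_mul_norm_sq_le (γ₀ := (c * α + d * β) / v)
    (continuous_energy (A := A) (B := B) (c := c) (d := d)) energy_smul
    (fun f hf => (div_lt_iff₀' hv).mpr (h_gt f hf))
  have hγ_pos : 0 < γ := lt_of_le_of_lt (by positivity) hγ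
  have h_obj : v ≤ (c * α + d * β) / γ :=
    (h_min _ (div_mem_dominatingPairs hc hd hγ_pos hle)).trans_eq (by ring)
  rw [le_div_iff₀ hγ_pos] at h_obj
  exact h_obj.not_gt ((div_lt_iff₀' hv).mp hγ)

/-- The competitors `(c + t a, d + t b)`, rescaled until they are feasible, cannot lower the
objective; let `t → 0`. -/
theorem exists_tight_mul_energy_le [FiniteDimensional 𝕜 H] {α β a b : ℝ}
    (hcd : (c, d) ∈ dominatingPairs A B)
    (h_min : IsMinOn (fun p : ℝ × ℝ => p.1 * α + p.2 * β) (dominatingPairs A B) (c, d))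
    (hα : 0 ≤ α) (hβ : 0 ≤ β) (hv : 0 < c * α + d * β) (ha : 0 ≤ a) (hb : 0 ≤ b) :
    ∃ f ∈ tightSubspace hcd.2.2, f ≠ 0 ∧
      (c * α + d * β) * energy A B a b f ≤ (a * α + b * β) * ‖f‖ ^ 2 := by
  obtain ⟨hc : 0 ≤ c, hd : 0 ≤ d, h_dom : ∀ f, ‖f‖ ^ 2 ≤ energy A B c d f⟩ := hcd
  set v := c * α + d * β
  set w := a * α + b * β
  have h_perturbed : ∀ t > 0, ∃ f ∈ Metric.sphere (0 : H) 1,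
      v * (energy A B c d f - 1) + t * (v * energy A B a b f - w) ≤ 0 := by
    intro t ht
    obtain ⟨f, hf, hle⟩ := exists_norm_eq_one_mul_energy_le hv (fun p hp => h_min hp) hα hβ
      (c := c + t * a) (d := d + t * b) (by positivity) (by positivity)
    refine ⟨f, mem_sphere_zero_iff_norm.mpr hf, ?_⟩
    simp only [energy] at hle ⊢
    linarith
  have : ProperSpace H := FiniteDimensional.proper_rclike 𝕜 H
  have h_continuous := @continuous_energy 𝕜 _ H _ _ E _ _ F _ _ A B
  obtain ⟨f, hf, h_tight, hle⟩ := exists_eq_zero_and_nonpos_of_forall_add_mul_nonpos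
    (isCompact_sphere (0 : H) 1) (by fun_prop) (by fun_prop)
    (fun f hf => mul_nonneg hv.le (by simpa [mem_sphere_zero_iff_norm.mp hf] using h_dom f))
    h_perturbed
  rw [mem_sphere_zero_iff_norm] at hf
  refine ⟨f, ?_, norm_ne_zero_iff.mp (by simp [hf]), ?_⟩
  · change energy A B c d f = ‖f‖ ^ 2
    rw [hf, one_pow, ← sub_eq_zero]
    exact (mul_eq_zero_iff_left hv.ne').mp h_tight
  · rw [hf, one_pow, mul_one]
    exact sub_nonpos.mp hle

theorem exists_tight_mul_norm_sq_le [FiniteDimensional 𝕜 H] {α β : ℝ}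
    (hcd : (c, d) ∈ dominatingPairs A B)
    (h_min : IsMinOn (fun p : ℝ × ℝ => p.1 * α + p.2 * β) (dominatingPairs A B) (c, d))
    (hα : 0 ≤ α) (hβ : 0 ≤ β) (hv : 0 < c * α + d * β) :
    ∃ u : H, u ≠ 0 ∧ (c * α + d * β) * ‖A u‖ ^ 2 ≤ α * ‖u‖ ^ 2 ∧
      (c * α + d * β) * ‖B u‖ ^ 2 ≤ β * ‖u‖ ^ 2 := by
  obtain ⟨f, hf_tight, hf, hfA⟩ := exists_tight_mul_energy_le hcd h_min hα hβ hv zero_le_one le_rfl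
  obtain ⟨g, hg_tight, hg, hgB⟩ := exists_tight_mul_energy_le hcd h_min hα hβ hv le_rfl zero_le_one
  simp only [energy, one_mul, zero_mul, add_zero, zero_add] at hfA hgB
  set v := c * α + d * β with hv_def
  let q : H → ℝ := fun u => v * ‖A u‖ ^ 2 - α * ‖u‖ ^ 2
  let r : H → ℝ := fun u => v * ‖B u‖ ^ 2 - β * ‖u‖ ^ 2
  have h_balance : ∀ u ∈ tightSubspace hcd.2.2, c * q u + d * r u = 0 := by
    intro u (hu : c * ‖A u‖ ^ 2 + d * ‖B u‖ ^ 2 = ‖u‖ ^ 2)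
    simp only [q, r]
    linear_combination v * hu - ‖u‖ ^ 2 * hv_def
  have hc : 0 ≤ c := hcd.1
  have hd : 0 ≤ d := hcd.2.1
  rcases le_or_gt (q g) 0 with hgA | hgA
  · exact ⟨g, hg, sub_nonpos.mp hgA, hgB⟩
  have hd_pos : 0 < d := by
    refine hd.lt_of_ne' fun hd0 => ?_
    have hc_pos : 0 < c := hc.lt_of_ne' fun hc0 => by simp [v, hc0, hd0] at hv
    have := h_balance g hg_tight
    rw [hd0, zero_mul, add_zero] at this
    exact (mul_pos hc_pos hgA).ne' this
  have hq : Continuous q := by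
    have : Continuous A := A.continuous_of_finiteDimensional
    fun_prop
  have hq_smul : ∀ (a : 𝕜) (u : H), q (a • u) = ‖a‖ ^ 2 * q u := by
    intro a u
    simp only [q, map_smul, norm_smul]
    ring
  obtain ⟨u, hu_tight, hu, hqu⟩ := exists_mem_ne_zero_eq_zero_of_nonpos_of_nonneg hq hq_smul
    hf_tight hg_tight hf (sub_nonpos.mpr hfA) hg hgA.le
  have hru : d * r u = 0 := by simpa [hqu] using h_balance u hu_tight
  exact ⟨u, hu, (sub_eq_zero.mp hqu).le,
    (sub_eq_zero.mp ((mul_eq_zero_iff_left hd_pos.ne').mp hru)).le⟩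

/-- Strong duality: the semidefinite program is the Lagrangian dual of maximizing `‖f‖²` subject
to `‖A f‖ ≤ ε` and `‖B f‖ ≤ η`. -/
theorem exists_norm_sq_eq_of_isMinOn [FiniteDimensional 𝕜 H] (hε : 0 ≤ ε) (hη : 0 ≤ η)
    (hcd : (c, d) ∈ dominatingPairs A B)
    (h_min : IsMinOn (fun p : ℝ × ℝ => p.1 * ε ^ 2 + p.2 * η ^ 2) (dominatingPairs A B) (c, d)) :
    ∃ f : H, ‖A f‖ ≤ ε ∧ ‖B f‖ ≤ η ∧ ‖f‖ ^ 2 = c * ε ^ 2 + d * η ^ 2 := by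
  have hc : 0 ≤ c := hcd.1
  have hd : 0 ≤ d := hcd.2.1
  rcases (show 0 ≤ c * ε ^ 2 + d * η ^ 2 by positivity).eq_or_lt' with hv | hv
  · exact ⟨0, by simpa, by simpa, by simp [hv]⟩
  obtain ⟨u, hu, huA, huB⟩ :=
    exists_tight_mul_norm_sq_le hcd h_min (sq_nonneg ε) (sq_nonneg η) hv
  set v := c * ε ^ 2 + d * η ^ 2
  have hu_pos : 0 < ‖u‖ ^ 2 := by positivity
  have h_scale : ‖((√v / ‖u‖ : ℝ) : 𝕜)‖ ^ 2 = v / ‖u‖ ^ 2 := by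
    rw [RCLike.norm_ofReal, sq_abs, div_pow, Real.sq_sqrt hv.le]
  refine ⟨((√v / ‖u‖ : ℝ) : 𝕜) • u, le_of_sq_le_sq ?_ hε, le_of_sq_le_sq ?_ hη, ?_⟩
  · rwa [map_smul, norm_smul, mul_pow, h_scale, div_mul_eq_mul_div, div_le_iff₀ hu_pos]
  · rwa [map_smul, norm_smul, mul_pow, h_scale, div_mul_eq_mul_div, div_le_iff₀ hu_pos]
  · rw [norm_smul, mul_pow, h_scale, div_mul_cancel₀ _ hu_pos.ne']

theorem tikhonov_add_of_normal_equations {y : F} {x : H}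
    (hx : ∀ g, (c : 𝕜) * ⟪A x, A g⟫_𝕜 + (d : 𝕜) * ⟪B x - y, B g⟫_𝕜 = 0) (g : H) :
    tikhonov A B c d y (x + g) = tikhonov A B c d y x + energy A B c d g := by
  have h_re := congrArg RCLike.re (hx g)
  rw [map_add, RCLike.re_ofReal_mul, RCLike.re_ofReal_mul, map_zero] at h_re
  simp only [tikhonov, energy, map_add]
  rw [add_sub_right_comm, norm_add_sq (𝕜 := 𝕜) (A x), norm_add_sq (𝕜 := 𝕜) (B x - y)]
  linear_combination 2 * h_re

theorem tikhonov_eq_add_energy_sub {y : F} {x : H}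
    (hx : ∀ g, (c : 𝕜) * ⟪A x, A g⟫_𝕜 + (d : 𝕜) * ⟪B x - y, B g⟫_𝕜 = 0) (f : H) :
    tikhonov A B c d y f = tikhonov A B c d y x + energy A B c d (f - x) := by
  rw [← tikhonov_add_of_normal_equations hx, add_sub_cancel]

theorem isMinOn_tikhonov_iff (hcd : (c, d) ∈ dominatingPairs A B) {y : F} {x f : H}
    (hx : ∀ g, (c : 𝕜) * ⟪A x, A g⟫_𝕜 + (d : 𝕜) * ⟪B x - y, B g⟫_𝕜 = 0) :
    IsMinOn (tikhonov A B c d y) Set.univ f ↔ f = x := by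
  obtain ⟨hc, hd, h_dom⟩ := hcd
  have h_pyth := tikhonov_eq_add_energy_sub hx
  refine ⟨fun h_min => ?_, ?_⟩
  · have h_le : tikhonov A B c d y f ≤ tikhonov A B c d y x := h_min (Set.mem_univ x)
    have h_sq : ‖f - x‖ ^ 2 ≤ 0 := (h_dom _).trans (by linarith [h_pyth f])
    exact sub_eq_zero.mp (by simpa using h_sq.antisymm (sq_nonneg _))
  · rintro rfl
    refine isMinOn_univ_iff.mpr fun g => ?_
    rw [h_pyth g]
    exact le_add_of_nonneg_right (energy_nonneg hc hd _)

theorem norm_sub_sq_le_tikhonov (hcd : (c, d) ∈ dominatingPairs A B) {y : F} {x : H}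
    (hx : ∀ g, (c : 𝕜) * ⟪A x, A g⟫_𝕜 + (d : 𝕜) * ⟪B x - y, B g⟫_𝕜 = 0) (f : H) :
    ‖f - x‖ ^ 2 ≤ tikhonov A B c d y f := by
  obtain ⟨hc : 0 ≤ c, hd : 0 ≤ d, h_dom⟩ := hcd
  have h_nonneg : 0 ≤ tikhonov A B c d y x := by unfold tikhonov; positivity
  linarith [h_dom (f - x), tikhonov_eq_add_energy_sub hx f]

section NormalOp

variable [FiniteDimensional 𝕜 H] [FiniteDimensional 𝕜 E] [FiniteDimensional 𝕜 F]

/-- The operator `c A* A + d B* B` of the normal equations. -/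
noncomputable def normalOp (A : H →ₗ[𝕜] E) (B : H →ₗ[𝕜] F) (c d : ℝ) : H →ₗ[𝕜] H :=
  (c : 𝕜) • (LinearMap.adjoint A ∘ₗ A) + (d : 𝕜) • (LinearMap.adjoint B ∘ₗ B)

theorem inner_normalOp (f g : H) :
    ⟪normalOp A B c d f, g⟫_𝕜 = (c : 𝕜) * ⟪A f, A g⟫_𝕜 + (d : 𝕜) * ⟪B f, B g⟫_𝕜 := by
  simp [normalOp, inner_add_left, inner_smul_left, LinearMap.adjoint_inner_left]

theorem re_inner_normalOp_self (f : H) :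
    RCLike.re ⟪normalOp A B c d f, f⟫_𝕜 = energy A B c d f := by
  rw [inner_normalOp, map_add, RCLike.re_ofReal_mul, RCLike.re_ofReal_mul,
    ← norm_sq_eq_re_inner, ← norm_sq_eq_re_inner, energy]

theorem isSymmetric_normalOp : (normalOp A B c d).IsSymmetric := by
  intro f g
  rw [← inner_conj_symm f, inner_normalOp, inner_normalOp]
  simp

theorem isPositive_normalOp_sub_id_iff :
    (normalOp A B c d - LinearMap.id).IsPositive ↔ ∀ f, ‖f‖ ^ 2 ≤ energy A B c d f := by
  have h_symm : (normalOp A B c d - LinearMap.id).IsSymmetric :=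
    isSymmetric_normalOp.sub fun _ _ => rfl
  simp only [LinearMap.IsPositive, h_symm, true_and, LinearMap.sub_apply, LinearMap.id_apply,
    inner_sub_left, map_sub, re_inner_normalOp_self, ← norm_sq_eq_re_inner, sub_nonneg]

theorem exists_linearMap_normal_equations (h_dom : ∀ f, ‖f‖ ^ 2 ≤ energy A B c d f) :
    ∃ Δ : F →ₗ[𝕜] H, ∀ y g,
      (c : 𝕜) * ⟪A (Δ y), A g⟫_𝕜 + (d : 𝕜) * ⟪B (Δ y) - y, B g⟫_𝕜 = 0 := by
  have h_inj : Function.Injective (normalOp A B c d) := by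
    refine (injective_iff_map_eq_zero _).mpr fun f hf => ?_
    have h_energy := h_dom f
    rw [← re_inner_normalOp_self, hf, inner_zero_left, map_zero] at h_energy
    simpa using h_energy.antisymm (sq_nonneg _)
  refine ⟨(LinearEquiv.ofInjectiveEndo _ h_inj).symm.toLinearMap ∘ₗ
    ((d : 𝕜) • LinearMap.adjoint B), fun y g => ?_⟩
  set x := (LinearEquiv.ofInjectiveEndo _ h_inj).symm ((d : 𝕜) • LinearMap.adjoint B y)
  have h_normal : normalOp A B c d x = (d : 𝕜) • LinearMap.adjoint B y :=
    (LinearEquiv.ofInjectiveEndo _ h_inj).apply_symm_apply _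
  have h_inner : ⟪normalOp A B c d x, g⟫_𝕜 = (d : 𝕜) * ⟪y, B g⟫_𝕜 := by
    rw [h_normal, inner_smul_left, LinearMap.adjoint_inner_left, RCLike.conj_ofReal]
  rw [inner_normalOp] at h_inner
  change (c : 𝕜) * ⟪A x, A g⟫_𝕜 + (d : 𝕜) * ⟪B x - y, B g⟫_𝕜 = 0
  rw [inner_sub_left]
  linear_combination h_inner

end NormalOp

end Energy

section Recovery

variable {𝕜 : Type*} [RCLike 𝕜] {H : Type*} [NormedAddCommGroup H] [InnerProductSpace 𝕜 H]
  {m : ℕ} {K : Set H} {S : Set (EuclideanSpace 𝕜 (Fin m))} {V : Submodule 𝕜 H}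
  {Λ : H →ₗ[𝕜] EuclideanSpace 𝕜 (Fin m)} {Δ : EuclideanSpace 𝕜 (Fin m) → H} {c d ε η : ℝ}

theorem enorm_sub_le_gwce {f : H} {e : EuclideanSpace 𝕜 (Fin m)} (hf : f ∈ K) (he : e ∈ S) :
    ‖f - Δ (Λ f + e)‖ₑ ≤ gwce K S Λ Δ :=
  le_iSup₂_of_le f hf (le_iSup₂_of_le e he le_rfl)

theorem enorm_le_gwce {f : H} (hf : f ∈ K) (hf_neg : -f ∈ K) (hΛf : Λ f ∈ S)
    (hΛf_neg : -Λ f ∈ S) : ‖f‖ₑ ≤ gwce K S Λ Δ := by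
  have h_pos : ‖f - Δ 0‖ₑ ≤ gwce K S Λ Δ := by
    simpa using enorm_sub_le_gwce (Λ := Λ) (Δ := Δ) hf hΛf_neg
  have h_neg : ‖f + Δ 0‖ₑ ≤ gwce K S Λ Δ := by
    rw [← enorm_neg, neg_add']
    simpa using enorm_sub_le_gwce (Λ := Λ) (Δ := Δ) hf_neg hΛf
  rcases le_max_iff.mp (norm_le_max_norm_sub_norm_add 𝕜 f (Δ 0)) with h | h
  · exact (enorm_le_iff_norm_le.mpr h).trans h_pos
  · exact (enorm_le_iff_norm_le.mpr h).trans h_neg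

theorem gwce_eq_iInf_of_forall_norm_sub_le {f : H} (hf : f ∈ K) (hf_neg : -f ∈ K)
    (hΛf : Λ f ∈ S) (hΛf_neg : -Λ f ∈ S)
    (h : ∀ g ∈ K, ∀ e ∈ S, ‖g - Δ (Λ g + e)‖ ≤ ‖f‖) :
    gwce K S Λ Δ = ⨅ Δ' : EuclideanSpace 𝕜 (Fin m) → H, gwce K S Λ Δ' := by
  have h_le : gwce K S Λ Δ ≤ ‖f‖ₑ :=
    iSup₂_le fun g hg => iSup₂_le fun e he => enorm_le_iff_norm_le.mpr (h g hg e he)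
  exact le_antisymm (le_iInf fun _ => h_le.trans (enorm_le_gwce hf hf_neg hΛf hΛf_neg))
    (iInf_le _ _)

variable [FiniteDimensional 𝕜 H]

theorem mem_approxSet_iff {f : H} : f ∈ approxSet V ε ↔ ‖Vᗮ.starProjection f‖ ≤ ε := by
  rw [approxSet, Set.mem_ofPred_eq, V.starProjection_orthogonal_val, V.starProjection_minimal,
    Metric.infDist_eq_iInf]
  simp [dist_eq_norm]

theorem ker_starProjection_orthogonal :
    LinearMap.ker (Vᗮ.starProjection : H →ₗ[𝕜] H) = V := by
  rw [Submodule.ker_starProjection, Submodule.orthogonal_orthogonal]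

theorem normalOp_starProjection :
    normalOp (Vᗮ.starProjection : H →ₗ[𝕜] H) Λ c d =
      (c : 𝕜) • (Vᗮ.starProjection : H →ₗ[𝕜] H) + (d : 𝕜) • (LinearMap.adjoint Λ ∘ₗ Λ) := by
  have h_adjoint : LinearMap.adjoint (Vᗮ.starProjection : H →ₗ[𝕜] H) = Vᗮ.starProjection :=
    (LinearMap.isSymmetric_iff_isSelfAdjoint _).mp Vᗮ.starProjection_isSymmetric
  have h_idem : (Vᗮ.starProjection : H →ₗ[𝕜] H) ∘ₗ (Vᗮ.starProjection : H →ₗ[𝕜] H) =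
      Vᗮ.starProjection :=
    LinearMap.ext fun f =>
      Submodule.starProjection_eq_self_iff.mpr (Submodule.starProjection_apply_mem _ f)
  rw [normalOp, h_adjoint, h_idem]

theorem sdpFeasible_eq_dominatingPairs :
    sdpFeasible V Λ = dominatingPairs (Vᗮ.starProjection : H →ₗ[𝕜] H) Λ := by
  ext ⟨c, d⟩
  simp only [sdpFeasible, dominatingPairs, Set.mem_ofPred_eq, ← normalOp_starProjection,
    isPositive_normalOp_sub_id_iff]

theorem exists_isSDPSolution (hV : V ⊓ LinearMap.ker Λ = ⊥) (hε : 0 < ε) (hη : 0 < η) :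
    ∃ c d : ℝ, IsSDPSolution V Λ ε η c d := by
  have h_ker : LinearMap.ker (Vᗮ.starProjection : H →ₗ[𝕜] H) ⊓ LinearMap.ker Λ = ⊥ := by
    rwa [ker_starProjection_orthogonal]
  obtain ⟨⟨c, d⟩, h_mem, h_min⟩ :=
    exists_isMinOn_dominatingPairs h_ker (sq_pos_of_pos hε) (sq_pos_of_pos hη)
  rw [← sdpFeasible_eq_dominatingPairs] at h_mem h_min
  exact ⟨c, d, h_mem, h_min⟩

theorem tikhonov_eq_mul_regObjective (hcd : c + d ≠ 0) (y : EuclideanSpace 𝕜 (Fin m)) (f : H) :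
    tikhonov (Vᗮ.starProjection : H →ₗ[𝕜] H) Λ c d y f =
      (c + d) * regObjective V Λ (d / (c + d)) y f := by
  simp only [tikhonov, regObjective, ContinuousLinearMap.coe_coe]
  field_simp
  ring

theorem isRegularizationMap_of_normal_equations
    (hcd : (c, d) ∈ dominatingPairs (Vᗮ.starProjection : H →ₗ[𝕜] H) Λ)
    (hΔ : ∀ y g, (c : 𝕜) * ⟪Vᗮ.starProjection (Δ y), Vᗮ.starProjection g⟫_𝕜 +
      (d : 𝕜) * ⟪Λ (Δ y) - y, Λ g⟫_𝕜 = 0) :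
    IsRegularizationMap V Λ (d / (c + d)) Δ := by
  intro y f
  obtain ⟨hc : 0 ≤ c, hd : 0 ≤ d, h_dom⟩ := id hcd
  rcases (add_nonneg hc hd).eq_or_lt' with h_sum | h_sum
  · obtain ⟨rfl, rfl⟩ := (add_eq_zero_iff_of_nonneg hc hd).mp h_sum
    have h_zero : ∀ g : H, g = 0 := fun g => by
      simpa [energy] using (h_dom g).antisymm (by simp [energy])
    have : Subsingleton H := ⟨fun g g' => by rw [h_zero g, h_zero g']⟩
    exact iff_of_true (isMinOn_univ_iff.mpr fun g => by rw [Subsingleton.elim f g])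
      (Subsingleton.elim _ _)
  · rw [← isMinOn_tikhonov_iff hcd (hΔ y), isMinOn_univ_iff, isMinOn_univ_iff]
    simp only [tikhonov_eq_mul_regObjective h_sum.ne', mul_le_mul_iff_right₀ h_sum]

theorem norm_sub_sq_le_of_normal_equations
    (hcd : (c, d) ∈ dominatingPairs (Vᗮ.starProjection : H →ₗ[𝕜] H) Λ)
    (hΔ : ∀ y g, (c : 𝕜) * ⟪Vᗮ.starProjection (Δ y), Vᗮ.starProjection g⟫_𝕜 +
      (d : 𝕜) * ⟪Λ (Δ y) - y, Λ g⟫_𝕜 = 0)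
    {f : H} (hf : f ∈ approxSet V ε) {e : EuclideanSpace 𝕜 (Fin m)}
    (he : e ∈ uncertaintySet 𝕜 m η) :
    ‖f - Δ (Λ f + e)‖ ^ 2 ≤ c * ε ^ 2 + d * η ^ 2 := by
  have hc : 0 ≤ c := hcd.1
  have hd : 0 ≤ d := hcd.2.1
  have hf : ‖Vᗮ.starProjection f‖ ≤ ε := mem_approxSet_iff.mp hf
  have he : ‖e‖ ≤ η := he
  calc ‖f - Δ (Λ f + e)‖ ^ 2
      ≤ tikhonov (Vᗮ.starProjection : H →ₗ[𝕜] H) Λ c d (Λ f + e) f :=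
        norm_sub_sq_le_tikhonov hcd (hΔ _) f
    _ = c * ‖Vᗮ.starProjection f‖ ^ 2 + d * ‖e‖ ^ 2 := by
        simp only [tikhonov, ContinuousLinearMap.coe_coe, sub_add_cancel_left, norm_neg]
    _ ≤ c * ε ^ 2 + d * η ^ 2 := by gcongr

end Recovery

end OptRec

theorem mainTheorem3 {𝕜 : Type*} [RCLike 𝕜] {H : Type*} [NormedAddCommGroup H]
    [InnerProductSpace 𝕜 H] [FiniteDimensional 𝕜 H] {m : ℕ}
    (V : Submodule 𝕜 H) (Λ : H →ₗ[𝕜] EuclideanSpace 𝕜 (Fin m))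
    (hV : V ⊓ LinearMap.ker Λ = ⊥) (ε η : ℝ) (hε : 0 < ε) (hη : 0 ≤ η) :
    (0 < η → ∃ c d : ℝ, OptRec.IsSDPSolution V Λ ε η c d) ∧
    ∀ c d : ℝ, OptRec.IsSDPSolution V Λ ε η c d →
      ∃ Δ : EuclideanSpace 𝕜 (Fin m) →ₗ[𝕜] H,
        OptRec.IsRegularizationMap V Λ (d / (c + d)) Δ ∧
        OptRec.gwce (OptRec.approxSet V ε) (OptRec.uncertaintySet 𝕜 m η) Λ Δ =
          ⨅ Δ' : EuclideanSpace 𝕜 (Fin m) → H,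
            OptRec.gwce (OptRec.approxSet V ε) (OptRec.uncertaintySet 𝕜 m η) Λ Δ' := by
  refine ⟨OptRec.exists_isSDPSolution hV hε, fun c d ⟨h_mem, h_min⟩ => ?_⟩
  rw [OptRec.sdpFeasible_eq_dominatingPairs] at h_mem h_min
  obtain ⟨Δ, hΔ⟩ := OptRec.exists_linearMap_normal_equations h_mem.2.2
  obtain ⟨f, hfV, hfΛ, hf⟩ := OptRec.exists_norm_sq_eq_of_isMinOn hε.le hη h_mem h_min
  refine ⟨Δ, OptRec.isRegularizationMap_of_normal_equations h_mem hΔ,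
    OptRec.gwce_eq_iInf_of_forall_norm_sub_le (f := f) ?_ ?_ ?_ ?_ fun g hg e he => ?_⟩
  · exact OptRec.mem_approxSet_iff.mpr hfV
  · exact OptRec.mem_approxSet_iff.mpr (by rwa [map_neg, norm_neg])
  · exact hfΛ
  · exact (norm_neg (Λ f)).trans_le hfΛ
  · exact le_of_sq_le_sq
      ((OptRec.norm_sub_sq_le_of_normal_equations h_mem hΔ hg he).trans_eq hf.symm) (norm_nonneg f)
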